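/- Let $X$ be a real locally convex topological vector space with topological dual $X^*$, and let $f_1,f_2\colon X\to(-\infty,\infty]$ be convex functions that are proper, i.e. the sets $\operatorname{dom} f_i:=\{x\in X: f_i(x)<\infty\}$ are nonempty. For $\Omega\subset X$ let $$\operatorname{qri}(\Omega):=\{x\in\Omega:\ \overline{\operatorname{cone}(\Omega-x)}\ \text{is a linear subspace of } X\},\qquad \operatorname{cone}(A):=\{ta:\ t\ge 0,\ a\in A\},$$ be its quasi-relative interior, and for $f\colon X\to(-\infty,\infty]$ and $\bar x\in\operatorname{dom} f$ let $$\partial f(\bar x):=\{x^*\in X^*:\ \langle x^*,x-\bar x\rangle\le f(x)-f(\bar x)\ \text{for all } x\in X\}.$$ Suppose that $f_1$ is polyhedral, i.e. its epigraph $\{(x,r)\in X\times\mathbb R: f_1(x)\le r\}$ is the set of solutions in $X\times\mathbb R$ of finitely many inequalities $\langle u_i,\cdot\rangle\le\alpha_i$ with $u_i\in(X\times\mathbb R)^*$ and $\alpha_i\in\mathbb R$, and that $$\operatorname{dom} f_1\cap\operatorname{qri}(\operatorname{dom} f_2)\neq\emptyset.$$ Then $$\partial(f_1+f_2)(\bar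 x)=\partial f_1(\bar x)+\partial f_2(\bar x)\quad\text{for all }\bar x\in\operatorname{dom} f_1\cap\operatorname{dom} f_2.$$ -/

import Mathlib

open scoped Pointwise

namespace ConvexLCTV

/-- The effective domain `{x | f x < ∞}`. -/
def dom {X : Type*} (f : X → EReal) : Set X := {x | f x < ⊤}

/-- The epigraph of an extended-real-valued function, as a subset of `X × ℝ`. -/
def epi {X : Type*} (f : X → EReal) : Set (X × ℝ) := {p | f p.1 ≤ (p.2 : EReal)}

/-- A proper function: it takes values in `(-∞, ∞]` and is not identically `∞`. -/
def IsProper {X : Type*} (f : X → EReal) : Prop := (∀ x, f x ≠ ⊥) ∧ (dom f).Nonempty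

/-- An extended-real-valued function is convex when its epigraph is convex. -/
def IsConvexFun {X : Type*} [AddCommGroup X] [Module ℝ X] (f : X → EReal) : Prop :=
  Convex ℝ (epi f)

/-- A convex polyhedron: the intersection of finitely many closed half-spaces
given by continuous linear functionals. -/
def IsPolyhedral {X : Type*} [AddCommGroup X] [Module ℝ X] [TopologicalSpace X]
    (P : Set X) : Prop :=
  ∃ (k : ℕ) (u : Fin k → (X →L[ℝ] ℝ)) (a : Fin k → ℝ), P = {x | ∀ i, u i x ≤ a i}

/-- A polyhedral function: its epigraph is a convex polyhedron in `X × ℝ`. -/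
def IsPolyhedralFun {X : Type*} [AddCommGroup X] [Module ℝ X] [TopologicalSpace X]
    (f : X → EReal) : Prop :=
  IsPolyhedral (epi f)

/-- The conic hull `{t a | t ≥ 0, a ∈ A}`. -/
def conicHull {X : Type*} [AddCommGroup X] [Module ℝ X] (A : Set X) : Set X :=
  {y | ∃ t : ℝ, 0 ≤ t ∧ ∃ a ∈ A, y = t • a}

/-- The quasi-relative interior: the points `x ∈ Ω` such that the closure of
the conic hull of `Ω - x` is a linear subspace. -/
def qri {X : Type*} [AddCommGroup X] [Module ℝ X] [TopologicalSpace X]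
    (Ω : Set X) : Set X :=
  {x | x ∈ Ω ∧ ∃ S : Submodule ℝ X,
    (S : Set X) = closure (conicHull ((fun w => w - x) '' Ω))}

/-- The subdifferential of `f` at `x₀` (it is empty when `f x₀ = ∞`, by the conventions of
`EReal` for subtraction). -/
def subdifferential {X : Type*} [AddCommGroup X] [Module ℝ X] [TopologicalSpace X]
    (f : X → EReal) (x₀ : X) : Set (X →L[ℝ] ℝ) :=
  {u | ∀ x, ((u (x - x₀) : ℝ) : EReal) ≤ f x - f x₀}

end ConvexLCTV

/-!
The nontrivial inclusion is a Lagrange multiplier theorem. Let `u` be a subgradient of `f₁ + f₂`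
at `x` and put `c = f₁ x + f₂ x`. On the convex set `dom f₂ × ℝ` the convex function
`(y, r) ↦ r + f₂ y - u (y - x) - c` is nonnegative wherever the finitely many affine constraints
describing `epi f₁` hold. If it stays nonnegative on all of `dom f₂ × ℝ` after adding
a continuous affine function `w - α` that is nonpositive on `epi f₁`, then letting `r` vary forces
`w (y, r) = v y - r`, and `v` is a subgradient of `f₁` at `x`, `u - v` one of `f₂`.

The multiplier exists without any interior point or closedness because the constraints are affine
(`exists_affine_nonneg_add`). The hypothesis on the quasi-relative interior enters only through its
dual form `NoProperSupport`: a continuous linear functional that attains its minimum over the set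
at the given point is constant on the set. The proof removes the constraints one at a time. If the
constraint can be satisfied strictly together with the others, a one-dimensional argument
supplies its multiplier. Otherwise induction shows that, on the convex set, its negative is
dominated by the other constraints, so it holds with equality; the set is cut down to the
hyperplane of equality, which preserves `NoProperSupport`, and the multiplier obtained there may
have any sign. The one-dimensional argument is `exists_mul_nonneg_of_nonneg_of_eq`: a convex
function that is nonnegative on a hyperplane section becomes nonnegative after adding a multiple
of the equation of the hyperplane.
-/

namespace ConvexLCTV

/-! ### Multipliers for a single affine constraint -/

section Multipliers

variable {Z : Type*} [AddCommGroup Z] [Module ℝ Z] [TopologicalSpace Z]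

/-- The point `z₀` of `D` is not a proper support point of `D`: every continuous linear functional
attaining its minimum over `D` at `z₀` is constant on `D`. This is the dual form of
`z₀ ∈ qri D`. -/
def NoProperSupport (D : Set Z) (z₀ : Z) : Prop :=
  z₀ ∈ D ∧ ∀ v : Z →L[ℝ] ℝ, (∀ z ∈ D, v z₀ ≤ v z) → ∀ z ∈ D, v z = v z₀

/-- Multiplier for an affine equation which changes sign on `D`: the slopes of `φ` against
`v - a` on the two sides of the hyperplane are separated, because segments crossing
the hyperplane meet it in a point where `φ` is nonnegative. -/
theorem exists_mul_nonneg_of_changes_sign {D : Set Z} {φ : Z → ℝ} (hφ : ConvexOn ℝ D φ)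
    (v : Z →L[ℝ] ℝ) (a : ℝ) (h : ∀ z ∈ D, v z = a → 0 ≤ φ z)
    (hpos : ∃ z ∈ D, a < v z) (hneg : ∃ z ∈ D, v z < a) :
    ∃ β : ℝ, ∀ z ∈ D, 0 ≤ φ z + β * (v z - a) := by
  have key : ∀ x ∈ D, ∀ y ∈ D, a < v x → v y < a →
      -φ x / (v x - a) ≤ φ y / (a - v y) := by
    intro x hx y hy hvx hvy
    have hp : 0 < v x - a := by linarith
    have hq : 0 < a - v y := by linarith
    have hpq : 0 < (v x - a) + (a - v y) := by linarith
    have hs : (a - v y) / ((v x - a) + (a - v y)) + (v x - a) / ((v x - a) + (a - v y)) = 1 := by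
      field_simp
      ring
    have hz := hφ.1 hx hy (by positivity) (by positivity) hs
    have hle := hφ.2 hx hy (by positivity) (by positivity) hs
    have h0 := h _ hz (by
      simp only [map_add, map_smul, smul_eq_mul]
      field_simp
      ring)
    have h1 := h0.trans hle
    simp only [smul_eq_mul] at h1
    have h2 : 0 ≤ (a - v y) * φ x + (v x - a) * φ y := by
      have := mul_nonneg hpq.le h1
      field_simp at this
      linarith
    rw [div_le_div_iff₀ hp hq]
    linarith
  obtain ⟨x₀, hx₀, hvx₀⟩ := hpos
  obtain ⟨y₀, hy₀, hvy₀⟩ := hneg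
  set S : Set ℝ := {t | ∃ x ∈ D, a < v x ∧ t = -φ x / (v x - a)} with hS
  have hbdd : BddAbove S := by
    refine ⟨φ y₀ / (a - v y₀), ?_⟩
    rintro _ ⟨x, hx, hvx, rfl⟩
    exact key x hx y₀ hy₀ hvx hvy₀
  refine ⟨sSup S, fun z hz => ?_⟩
  rcases lt_trichotomy (v z) a with hlt | heq | hgt
  · have hle : sSup S ≤ φ z / (a - v z) := by
      refine csSup_le ⟨_, x₀, hx₀, hvx₀, rfl⟩ ?_
      rintro _ ⟨x, hx, hvx, rfl⟩
      exact key x hx z hz hvx hlt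
    rw [le_div_iff₀ (by linarith)] at hle
    linarith
  · rw [heq, sub_self, mul_zero, add_zero]
    exact h z hz heq
  · have hle : -φ z / (v z - a) ≤ sSup S := le_csSup hbdd ⟨z, hz, hgt, rfl⟩
    rw [div_le_iff₀ (by linarith)] at hle
    linarith

theorem exists_mul_nonneg_of_nonneg_of_eq {D : Set Z} {φ : Z → ℝ} (hφ : ConvexOn ℝ D φ)
    {z₀ : Z} (hz₀ : NoProperSupport D z₀) (v : Z →L[ℝ] ℝ)
    (h : ∀ z ∈ D, v z = v z₀ → 0 ≤ φ z) :
    ∃ β : ℝ, ∀ z ∈ D, 0 ≤ φ z + β * (v z - v z₀) := by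
  by_cases hpos : ∃ z ∈ D, v z₀ < v z
  · by_cases hneg : ∃ z ∈ D, v z < v z₀
    · exact exists_mul_nonneg_of_changes_sign hφ v _ h hpos hneg
    · push Not at hneg
      exact ⟨0, fun z hz => by simpa using h z hz (hz₀.2 v hneg z hz)⟩
  · push Not at hpos
    refine ⟨0, fun z hz => ?_⟩
    have := hz₀.2 (-v) (fun z hz => by simpa using hpos z hz) z hz
    simpa using h z hz (by simpa using this)

/-- Multiplier for an affine inequality satisfying Slater's condition. -/
theorem exists_nonneg_mul_nonneg_of_slater {D : Set Z} {φ : Z → ℝ} (hφ : ConvexOn ℝ D φ)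
    (v : Z →L[ℝ] ℝ) (a : ℝ) (h : ∀ z ∈ D, v z ≤ a → 0 ≤ φ z) (hslater : ∃ z ∈ D, v z < a) :
    ∃ β : ℝ, 0 ≤ β ∧ ∀ z ∈ D, 0 ≤ φ z + β * (v z - a) := by
  by_cases hpos : ∃ z ∈ D, a < v z
  · obtain ⟨β, hβ⟩ := exists_mul_nonneg_of_changes_sign hφ v a (fun z hz e => h z hz e.le)
      hpos hslater
    rcases le_total 0 β with hβ0 | hβ0
    · exact ⟨β, hβ0, hβ⟩
    · -- With a negative multiplier `φ` is nonnegative on the far side too, so `0` is a multiplier.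
      refine ⟨0, le_rfl, fun z hz => ?_⟩
      rcases le_total (v z) a with hle | hle
      · simpa using h z hz hle
      · have := hβ z hz
        have := mul_nonneg (neg_nonneg.2 hβ0) (sub_nonneg.2 hle)
        linarith
  · push Not at hpos
    exact ⟨0, le_rfl, fun z hz => by simpa using h z hz (hpos z hz)⟩

theorem NoProperSupport.inter_hyperplane {D : Set Z} (hD : Convex ℝ D) {z₀ : Z}
    (hz₀ : NoProperSupport D z₀) (v : Z →L[ℝ] ℝ) :
    NoProperSupport (D ∩ {z | v z = v z₀}) z₀ := by
  refine ⟨⟨hz₀.1, rfl⟩, fun w hw z hz => ?_⟩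
  obtain ⟨β, hβ⟩ := exists_mul_nonneg_of_nonneg_of_eq (φ := fun z => w z + -w z₀)
    ((w.toLinearMap.convexOn hD).add (convexOn_const _ hD)) hz₀ v
    (fun y hy hvy => by linarith [hw y ⟨hy, hvy⟩])
  have hconst := hz₀.2 (w + β • v) (fun y hy => by
    have := hβ y hy
    simp only [add_apply, smul_apply, smul_eq_mul]
    linarith) z hz.1
  simp only [add_apply, smul_apply, smul_eq_mul] at hconst
  rw [show v z = v z₀ from hz.2] at hconst
  linarith

/-! ### Multipliers for a polyhedral constraint -/

theorem convex_setOf_forall_le {k : ℕ} (u : Fin k → (Z →L[ℝ] ℝ)) (a : Fin k → ℝ) :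
    Convex ℝ {z | ∀ i, u i z ≤ a i} := by
  rw [Set.ofPred_forall]
  exact convex_iInter fun i => convex_halfSpace_le (u i).toLinearMap.isLinear (a i)

/-- Lagrange multiplier theorem for polyhedral constraints. The combination of the constraints
with nonnegative multipliers is recorded only as a continuous affine function `w - α` that
is nonpositive wherever the constraints hold. -/
theorem exists_affine_nonneg_add {k : ℕ} (u : Fin k → (Z →L[ℝ] ℝ)) (a : Fin k → ℝ)
    {D : Set Z} {φ : Z → ℝ} (hφ : ConvexOn ℝ D φ) {z₀ : Z} (hz₀ : NoProperSupport D z₀)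
    (hfeas : ∀ i, u i z₀ ≤ a i) (h : ∀ z ∈ D, (∀ i, u i z ≤ a i) → 0 ≤ φ z) :
    ∃ (w : Z →L[ℝ] ℝ) (α : ℝ), (∀ z, (∀ i, u i z ≤ a i) → w z ≤ α) ∧
      ∀ z ∈ D, 0 ≤ φ z + (w z - α) := by
  induction k generalizing D φ with
  | zero => exact ⟨0, 0, fun z _ => by simp, fun z hz => by simpa using h z hz (by simp)⟩
  | succ k ih =>
    set u' : Fin k → (Z →L[ℝ] ℝ) := fun i => u i.succ with hu'
    set a' : Fin k → ℝ := fun i => a i.succ with ha'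
    have hfeas' : ∀ i, u' i z₀ ≤ a' i := fun i => hfeas i.succ
    have haff : ∀ β : ℝ, ConvexOn ℝ D fun z => (β • u 0) z + -(β * a 0) := fun β =>
      ((β • u 0).toLinearMap.convexOn hφ.1).add (convexOn_const _ hφ.1)
    by_cases hslater : ∃ z ∈ D ∩ {z | ∀ i, u' i z ≤ a' i}, u 0 z < a 0
    · obtain ⟨β, hβ0, hβ⟩ := exists_nonneg_mul_nonneg_of_slater
        (hφ.subset Set.inter_subset_left (hφ.1.inter (convex_setOf_forall_le u' a')))
        (u 0) (a 0) (fun z hz hle => h z hz.1 (Fin.forall_fin_succ.2 ⟨hle, hz.2⟩)) hslater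
      obtain ⟨w, α, hw, hwD⟩ := ih u' a' (hφ.add (haff β)) hz₀ hfeas' (fun z hz hz' => by
        have := hβ z ⟨hz, hz'⟩
        simp only [Pi.add_apply, smul_apply, smul_eq_mul]
        linarith)
      refine ⟨w + β • u 0, α + β * a 0, fun z hz => ?_, fun z hz => ?_⟩
      · have h1 := hw z fun i => hz i.succ
        have h2 := mul_le_mul_of_nonneg_left (hz 0) hβ0
        simp only [add_apply, smul_apply, smul_eq_mul]
        linarith
      · have := hwD z hz
        simp only [Pi.add_apply, add_apply, smul_apply, smul_eq_mul] at this ⊢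
        linarith
    · push Not at hslater
      have h0 : u 0 z₀ = a 0 := le_antisymm (hfeas 0) (hslater z₀ ⟨hz₀.1, hfeas'⟩)
      -- The first constraint is an implicit equality: on `D` it is the negative of `m - γ`.
      obtain ⟨m, γ, hm, hmD⟩ := ih u' a' (haff 1) hz₀ hfeas' (fun z hz hz' => by
        have := hslater z ⟨hz, hz'⟩
        simp only [smul_apply, smul_eq_mul]
        linarith)
      simp only [one_smul, one_mul] at hmD
      have hm0 : m z₀ = γ := le_antisymm (hm z₀ hfeas') (by linarith [hmD z₀ hz₀.1])
      have hneg : ∀ z ∈ D, u 0 z - a 0 = -(m z - γ) := by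
        intro z hz
        have := hz₀.2 (u 0 + m) (fun y hy => by
          simp only [add_apply]
          linarith [hmD y hy]) z hz
        simp only [add_apply] at this
        linarith
      have hconv : Convex ℝ (D ∩ {z | u 0 z = u 0 z₀}) :=
        hφ.1.inter (convex_hyperplane (u 0).toLinearMap.isLinear _)
      obtain ⟨w, α, hw, hwD⟩ := ih u' a' (hφ.subset Set.inter_subset_left hconv)
        (hz₀.inter_hyperplane hφ.1 (u 0)) hfeas' (fun z hz hz' =>
          h z hz.1 (Fin.forall_fin_succ.2 ⟨(hz.2.trans h0).le, hz'⟩))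
      obtain ⟨β, hβ⟩ := exists_mul_nonneg_of_nonneg_of_eq (φ := fun z => φ z + (w z + -α))
        (hφ.add ((w.toLinearMap.convexOn hφ.1).add (convexOn_const _ hφ.1))) hz₀ (u 0)
        (fun z hz hz' => by linarith [hwD z ⟨hz, hz'⟩])
      rw [h0] at hβ
      rcases le_total 0 β with hβ0 | hβ0
      · refine ⟨w + β • u 0, α + β * a 0, fun z hz => ?_, fun z hz => ?_⟩
        · have h1 := hw z fun i => hz i.succ
          have h2 := mul_le_mul_of_nonneg_left (hz 0) hβ0
          simp only [add_apply, smul_apply, smul_eq_mul]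
          linarith
        · have := hβ z hz
          simp only [add_apply, smul_apply, smul_eq_mul]
          linarith
      · -- A negative multiple of the first constraint is a positive multiple of `m - γ`.
        refine ⟨w + (-β) • m, α + (-β) * γ, fun z hz => ?_, fun z hz => ?_⟩
        · have h1 := hw z fun i => hz i.succ
          have h2 := mul_le_mul_of_nonneg_left (hm z fun i => hz i.succ) (neg_nonneg.2 hβ0)
          simp only [add_apply, smul_apply, smul_eq_mul]
          linarith
        · have := hβ z hz
          rw [hneg z hz] at this
          simp only [add_apply, smul_apply, smul_eq_mul]
          linarith

/-! ### Quasi-relative interior -/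

theorem noProperSupport_of_mem_qri {D : Set Z} {z₀ : Z} (hz₀ : z₀ ∈ qri D) :
    NoProperSupport D z₀ := by
  obtain ⟨hmem, S, hS⟩ := hz₀
  refine ⟨hmem, fun v hv z hz => ?_⟩
  have hpos : ∀ y ∈ S, 0 ≤ v y := by
    have hcl : closure (conicHull ((fun w => w - z₀) '' D)) ⊆ {y | 0 ≤ v y} := by
      refine closure_minimal ?_ (isClosed_le continuous_const v.continuous)
      rintro _ ⟨t, ht, _, ⟨y, hy, rfl⟩, rfl⟩
      simp only [Set.mem_ofPred_eq, map_smul, map_sub, smul_eq_mul]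
      exact mul_nonneg ht (sub_nonneg.2 (hv y hy))
    exact fun y hy => hcl (hS ▸ hy)
  have hzS : z - z₀ ∈ S := by
    rw [← SetLike.mem_coe, hS]
    exact subset_closure ⟨1, zero_le_one, _, ⟨z, hz, rfl⟩, (one_smul _ _).symm⟩
  have h1 := hpos _ (S.neg_mem hzS)
  simp only [map_neg, map_sub] at h1
  linarith [hv z hz]

theorem NoProperSupport.prod_univ {D : Set Z} {z₀ : Z} (hz₀ : NoProperSupport D z₀) (r₀ : ℝ) :
    NoProperSupport (D ×ˢ (Set.univ : Set ℝ)) (z₀, r₀) := by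
  refine ⟨⟨hz₀.1, trivial⟩, fun v hv => ?_⟩
  have hsplit : ∀ (y : Z) (r : ℝ), v (y, r) = v (y, 0) + r * v (0, 1) := by
    intro y r
    rw [← smul_eq_mul, ← map_smul, ← map_add]
    simp
  -- The functional attains its minimum along the whole vertical line through `(z₀, r₀)`.
  have h1 : v (0, 1) = 0 := by
    have hup := hv (z₀, r₀ + 1) ⟨hz₀.1, trivial⟩
    have hdown := hv (z₀, r₀ - 1) ⟨hz₀.1, trivial⟩
    rw [hsplit z₀ r₀, hsplit z₀ (_ + _)] at hup
    rw [hsplit z₀ r₀, hsplit z₀ (_ - _)] at hdown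
    linarith
  have hv' := hz₀.2 (v.comp (ContinuousLinearMap.inl ℝ Z ℝ)) (fun z hz => by
    have := hv (z, r₀) ⟨hz, trivial⟩
    rw [hsplit z₀, hsplit z, h1] at this
    simpa using this)
  rintro ⟨y, r⟩ ⟨hy, -⟩
  have := hv' y hy
  rw [hsplit y, hsplit z₀, h1]
  simpa using this

end Multipliers

/-! ### Real-valued descriptions of convexity and subgradients -/

section Functions

variable {X : Type*}

theorem coe_toReal_of_mem_dom {f : X → EReal} (hf : ∀ x, f x ≠ ⊥) {x : X} (hx : x ∈ dom f) :
    ((f x).toReal : EReal) = f x :=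
  EReal.coe_toReal (ne_of_lt hx) (hf x)

theorem dom_add {f g : X → EReal} (hf : ∀ x, f x ≠ ⊥) (hg : ∀ x, g x ≠ ⊥) :
    dom (f + g) = dom f ∩ dom g := by
  ext x
  refine ⟨fun hx => ?_, fun hx => EReal.add_lt_top hx.1.ne hx.2.ne⟩
  constructor
  · by_contra hfx
    have : f x = ⊤ := not_lt_top_iff.1 hfx
    simp [dom, this, EReal.top_add_of_ne_bot (hg x)] at hx
  · by_contra hgx
    have : g x = ⊤ := not_lt_top_iff.1 hgx
    simp [dom, this, EReal.add_top_of_ne_bot (hf x)] at hx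

theorem toReal_add_of_mem_dom {f g : X → EReal} (hf : ∀ x, f x ≠ ⊥) (hg : ∀ x, g x ≠ ⊥) {x : X}
    (hx : x ∈ dom f ∩ dom g) :
    ((f + g) x).toReal = (f x).toReal + (g x).toReal :=
  EReal.toReal_add hx.1.ne (hf x) hx.2.ne (hg x)

variable [AddCommGroup X] [Module ℝ X]

theorem convexOn_toReal {f : X → EReal} (hf : ∀ x, f x ≠ ⊥) (hc : IsConvexFun f) :
    ConvexOn ℝ (dom f) fun x => (f x).toReal := by
  have key : ∀ x ∈ dom f, ∀ y ∈ dom f, ∀ s t : ℝ, 0 ≤ s → 0 ≤ t → s + t = 1 →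
      f (s • x + t • y) ≤ ((s * (f x).toReal + t * (f y).toReal : ℝ) : EReal) := by
    intro x hx y hy s t hs ht hst
    have hx' : (x, (f x).toReal) ∈ epi f := (coe_toReal_of_mem_dom hf hx).ge
    have hy' : (y, (f y).toReal) ∈ epi f := (coe_toReal_of_mem_dom hf hy).ge
    exact hc hx' hy' hs ht hst
  have hdom : Convex ℝ (dom f) := fun x hx y hy s t hs ht hst =>
    (key x hx y hy s t hs ht hst).trans_lt (EReal.coe_lt_top _)
  refine ⟨hdom, fun x hx y hy s t hs ht hst => ?_⟩
  have := key x hx y hy s t hs ht hst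
  rw [← coe_toReal_of_mem_dom hf (hdom hx hy hs ht hst)] at this
  exact EReal.coe_le_coe_iff.1 this

theorem mem_subdifferential_iff [TopologicalSpace X] {f : X → EReal} (hf : ∀ x, f x ≠ ⊥) {x₀ : X}
    (hx₀ : x₀ ∈ dom f) {u : X →L[ℝ] ℝ} :
    u ∈ subdifferential f x₀ ↔
      ∀ x ∈ dom f, u (x - x₀) ≤ (f x).toReal - (f x₀).toReal := by
  refine forall_congr' fun x => ?_
  rw [← coe_toReal_of_mem_dom hf hx₀]
  by_cases hx : x ∈ dom f
  · rw [← coe_toReal_of_mem_dom hf hx, ← EReal.coe_sub, EReal.coe_le_coe_iff]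
    simp [hx]
  · have htop : f x = ⊤ := not_lt_top_iff.1 hx
    simp [htop, hx]

/-! ### The sum rule -/

theorem add_subset_subdifferential_add [TopologicalSpace X] {f g : X → EReal}
    (hf : ∀ x, f x ≠ ⊥) (hg : ∀ x, g x ≠ ⊥) {x₀ : X} (hx₀ : x₀ ∈ dom f ∩ dom g) :
    subdifferential f x₀ + subdifferential g x₀ ⊆ subdifferential (f + g) x₀ := by
  rintro _ ⟨v, hv, w, hw, rfl⟩
  have hfg : ∀ x, (f + g) x ≠ ⊥ := fun x => by simp [EReal.add_eq_bot_iff, hf x, hg x]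
  rw [mem_subdifferential_iff hf hx₀.1] at hv
  rw [mem_subdifferential_iff hg hx₀.2] at hw
  rw [mem_subdifferential_iff hfg (dom_add hf hg ▸ hx₀), dom_add hf hg]
  intro x hx
  rw [toReal_add_of_mem_dom hf hg hx, toReal_add_of_mem_dom hf hg hx₀]
  simp only [add_apply]
  linarith [hv x hx.1, hw x hx.2]

theorem subdifferential_add_subset [TopologicalSpace X]
    {f g : X → EReal} (hf : ∀ x, f x ≠ ⊥) (hg : ∀ x, g x ≠ ⊥)
    (hgc : IsConvexFun g) (hpoly : IsPolyhedralFun f)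
    (hqri : (dom f ∩ qri (dom g)).Nonempty) {x₀ : X} (hx₀ : x₀ ∈ dom f ∩ dom g) :
    subdifferential (f + g) x₀ ⊆ subdifferential f x₀ + subdifferential g x₀ := by
  intro u hu
  have hfg : ∀ x, (f + g) x ≠ ⊥ := fun x => by simp [EReal.add_eq_bot_iff, hf x, hg x]
  rw [mem_subdifferential_iff hfg (dom_add hf hg ▸ hx₀), dom_add hf hg] at hu
  obtain ⟨k, b, a, hepi⟩ := hpoly
  obtain ⟨q, hqf, hqg⟩ := hqri
  have hmem : ∀ y ∈ dom f, ∀ i, b i (y, (f y).toReal) ≤ a i := by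
    intro y hy
    have : (y, (f y).toReal) ∈ epi f := (coe_toReal_of_mem_dom hf hy).ge
    rwa [hepi] at this
  set c : ℝ := (f x₀).toReal + (g x₀).toReal with hc
  have hgR := convexOn_toReal hg hgc
  have hD : Convex ℝ (dom g ×ˢ (Set.univ : Set ℝ)) := hgR.1.prod convex_univ
  have hφ : ConvexOn ℝ (dom g ×ˢ (Set.univ : Set ℝ))
      fun z : X × ℝ => (g z.1).toReal + ((z.2 - u z.1) + (u x₀ - c)) := by
    refine ConvexOn.add ?_ (ConvexOn.add ?_ (convexOn_const _ hD))
    · exact (hgR.comp_linearMap (LinearMap.fst ℝ X ℝ)).subset (fun z hz => hz.1) hD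
    · exact (LinearMap.snd ℝ X ℝ - u.toLinearMap ∘ₗ LinearMap.fst ℝ X ℝ).convexOn hD
  obtain ⟨w, α, hw, hwD⟩ := exists_affine_nonneg_add b a hφ
    ((noProperSupport_of_mem_qri hqg).prod_univ (f q).toReal) (hmem q hqf) (by
      rintro ⟨y, r⟩ ⟨hy, -⟩ hyr
      have hfr : f y ≤ (r : EReal) := by
        have : (y, r) ∈ epi f := by rw [hepi]; exact hyr
        exact this
      have hyf : y ∈ dom f := hfr.trans_lt (EReal.coe_lt_top r)
      rw [← coe_toReal_of_mem_dom hf hyf, EReal.coe_le_coe_iff] at hfr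
      have := hu y ⟨hyf, hy⟩
      rw [toReal_add_of_mem_dom hf hg ⟨hyf, hy⟩, toReal_add_of_mem_dom hf hg hx₀, map_sub] at this
      simp only
      linarith)
  have hsplit : ∀ (y : X) (r : ℝ), w (y, r) = w (y, 0) + r * w (0, 1) := by
    intro y r
    rw [← smul_eq_mul, ← map_smul, ← map_add]
    simp
  -- A function affine in `r` and bounded below on `ℝ` has slope zero.
  have hslope : w (0, 1) = -1 := by
    by_contra hne
    have hne' : 1 + w (0, 1) ≠ 0 := fun h => hne (by linarith)
    set C : ℝ := (g x₀).toReal - c + w (x₀, 0) - α with hC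
    have := hwD (x₀, -(C + 1) / (1 + w (0, 1))) ⟨hx₀.2, trivial⟩
    rw [hsplit x₀ (_ / _)] at this
    have hcancel : -(C + 1) / (1 + w (0, 1)) * (1 + w (0, 1)) = -(C + 1) :=
      div_mul_cancel₀ _ hne'
    simp only at this
    linarith
  set v : X →L[ℝ] ℝ := w.comp (ContinuousLinearMap.inl ℝ X ℝ) with hv
  have hvw : ∀ y r, w (y, r) = v y - r := by
    intro y r
    rw [hsplit y, hslope]
    simp [hv, sub_eq_add_neg]
  have hvf : ∀ y ∈ dom f, v y - (f y).toReal ≤ α := fun y hy => by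
    simpa [hvw] using hw _ (hmem y hy)
  have hvg : ∀ y ∈ dom g, 0 ≤ (g y).toReal - u y + u x₀ - c + v y - α := fun y hy => by
    have := hwD (y, 0) ⟨hy, trivial⟩
    rw [hvw] at this
    simp only at this
    linarith
  -- Both estimates are equalities at `x₀`.
  have hα : v x₀ - (f x₀).toReal = α := by
    have h1 := hvf x₀ hx₀.1
    have h2 := hvg x₀ hx₀.2
    linarith
  refine ⟨v, ?_, u - v, ?_, by simp⟩
  · rw [mem_subdifferential_iff hf hx₀.1]
    intro y hy
    rw [map_sub]
    linarith [hvf y hy]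
  · rw [mem_subdifferential_iff hg hx₀.2]
    intro y hy
    simp only [sub_apply, map_sub]
    linarith [hvg y hy]

end Functions

end ConvexLCTV

theorem corollary5p3 {X : Type*} [AddCommGroup X] [Module ℝ X] [TopologicalSpace X]
    [IsTopologicalAddGroup X] [ContinuousSMul ℝ X] [LocallyConvexSpace ℝ X]
    (f₁ f₂ : X → EReal)
    (hf₁ : ConvexLCTV.IsProper f₁) (hf₁c : ConvexLCTV.IsConvexFun f₁)
    (hf₂ : ConvexLCTV.IsProper f₂) (hf₂c : ConvexLCTV.IsConvexFun f₂)
    (hpoly : ConvexLCTV.IsPolyhedralFun f₁)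
    (hqri : (ConvexLCTV.dom f₁ ∩ ConvexLCTV.qri (ConvexLCTV.dom f₂)).Nonempty) :
    ∀ x ∈ ConvexLCTV.dom f₁ ∩ ConvexLCTV.dom f₂,
      ConvexLCTV.subdifferential (f₁ + f₂) x =
        ConvexLCTV.subdifferential f₁ x + ConvexLCTV.subdifferential f₂ x := fun _ hx =>
  (ConvexLCTV.subdifferential_add_subset hf₁.1 hf₂.1 hf₂c hpoly hqri hx).antisymm
    (ConvexLCTV.add_subset_subdifferential_add hf₁.1 hf₂.1 hx)
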